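/- Let $n,m\in\mathbb N$ and let $\mathbf A=(a_{ij})\in\mathbb R^{n\times m}$ be such that the linear program $$\text{find } \mathbf x\in\mathbb R^m,\ \mathbf x\ge \mathbf 0,\ \text{ such that } \mathbf A\mathbf x\ge \mathbf 1 \text{ and } \sum_{j=1}^m x_j \text{ is minimal}$$ (inequalities between vectors are meant componentwise) has a unique optimal solution $\boldsymbol\kappa=(\kappa_1,\dots,\kappa_m)$, and suppose that $\mathbf A\boldsymbol\kappa=\mathbf 1$. Put $J=\{j\in\{1,\dots,m\}:\kappa_j>0\}$. Let $X_1,\dots,X_m$ be independent non-negative random variables. Assume that - for $j\in J$, $X_j$ is regularly varying with index $-1$, that is, $P(X_j>cx)/P(X_j>x)\to c^{-1}$ as $x\to\infty$ for every $c>0$ (with $P(X_j>x)>0$ for large $x$); - for $j\notin J$, $P(X_j\ge 1)=1$ and $E(X_j^{1-\delta})<\infty$ for all $\delta\in(0,1)$. Products of powers of non-negative numbers are evaluated in $[0,\infty]$ with the conventions $0^a=+\infty$ for $a<0$, $0^0=1$ and $+\infty\cdot 0=0$. Let $$M(\mathbf A)=\Big\{(x_1,\dots,x_m)\in[0,\infty)^m:\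 \prod_{j=1}^m x_j^{a_{ij}}>1,\ 1\le i\le n\Big\}.$$ Then $$\lim_{x\to\infty}\frac{P\big(\prod_{j=1}^m X_j^{a_{ij}}>x,\ 1\le i\le n\big)}{\prod_{j\in J}P(X_j>x^{\kappa_j})}=\int_{M(\mathbf A)}\ \prod_{j\in J}x_j^{-2}\ \lambda\big(\mathrm d(x_j)_{j\in J}\big)\otimes P^{(X_j)_{j\notin J}}\big(\mathrm d(x_j)_{j\notin J}\big),$$ and the integral on the right-hand side is finite. Here $\lambda$ is Lebesgue measure on $\mathbb R^{J}$ and $P^{(X_j)_{j\notin J}}$ is the joint law of $(X_j)_{j\notin J}$. -/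

import Mathlib

open MeasureTheory ProbabilityTheory Filter
open scoped Topology Matrix ENNReal

noncomputable section

namespace PowerProducts

/-- Feasibility for the linear program
`find x ≥ 0 such that A x ≥ 1 and ∑ j, x j is minimal` (componentwise inequalities). -/
def IsFeasible {n m : ℕ} (A : Matrix (Fin n) (Fin m) ℝ) (x : Fin m → ℝ) : Prop :=
  (∀ j, 0 ≤ x j) ∧ ∀ i, 1 ≤ (A *ᵥ x) i

/-- `x` is an optimal solution of the linear program. -/
def IsOptimal {n m : ℕ} (A : Matrix (Fin n) (Fin m) ℝ) (x : Fin m → ℝ) : Prop :=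
  IsFeasible A x ∧ ∀ y, IsFeasible A y → ∑ j, x j ≤ ∑ j, y j

/-- `κ` is the unique optimal solution of the linear program. -/
def IsUniqueOptimal {n m : ℕ} (A : Matrix (Fin n) (Fin m) ℝ) (κ : Fin m → ℝ) : Prop :=
  IsOptimal A κ ∧ ∀ y, IsOptimal A y → y = κ

/-- The real random variable `X` is regularly varying with index `ρ`: its survival function
`x ↦ P(X > x)` is eventually positive and varies regularly at infinity with index `ρ`.
(Survival functions are monotone, so the usual measurability requirement is automatic.) -/
def RegularlyVarying {Ω : Type*} [MeasurableSpace Ω] (P : Measure Ω) (X : Ω → ℝ) (ρ : ℝ) :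
    Prop :=
  (∀ᶠ x : ℝ in atTop, 0 < P.real {ω | x < X ω}) ∧
    ∀ c : ℝ, 0 < c →
      Tendsto (fun x : ℝ => P.real {ω | c * x < X ω} / P.real {ω | x < X ω}) atTop (𝓝 (c ^ ρ))

/-- The power product `∏ j, x j ^ a i j ∈ [0, ∞]` of a vector `x` with non-negative components.
It is computed in `[0, ∞]`, where `0 ^ a = ∞` for `a < 0`, `0 ^ 0 = 1` and `∞ * 0 = 0`. -/
def powerProd {n m : ℕ} (A : Matrix (Fin n) (Fin m) ℝ) (x : Fin m → ℝ) (i : Fin n) : ℝ≥0∞ :=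
  ∏ j, ENNReal.ofReal (x j) ^ A i j

/-- The set `M(A)` of all `x ∈ [0, ∞)^m` with `∏ j, x j ^ a i j > 1` for all `i`. -/
def M {n m : ℕ} (A : Matrix (Fin n) (Fin m) ℝ) : Set (Fin m → ℝ) :=
  {x | (∀ j, 0 ≤ x j) ∧ ∀ i, 1 < powerProd A x i}

/-- The measure `λ ⊗ P^{(X j) : κ j ≤ 0}` on `ℝ^m`: the product of Lebesgue measure in the
coordinates `j` with `κ j > 0` and the joint law of the `X j` in the remaining coordinates. The
two blocks of coordinates are put together by the canonical identification
`(Fin m → ℝ) ≃ ({j // 0 < κ j} → ℝ) × ({j // ¬ 0 < κ j} → ℝ)`. -/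
def lebesgueProdLaw {Ω : Type*} [MeasurableSpace Ω] (P : Measure Ω) {m : ℕ}
    (κ : Fin m → ℝ) (X : Fin m → Ω → ℝ) : Measure (Fin m → ℝ) :=
  ((volume : Measure ({j : Fin m // 0 < κ j} → ℝ)).prod
      (P.map (fun ω (j : {j : Fin m // ¬ 0 < κ j}) => X j ω))).map
    (MeasurableEquiv.piEquivPiSubtypeProd (fun _ : Fin m => ℝ) (fun j => 0 < κ j)).symm

end PowerProducts

end

/-! The event `{∏ j, X j ^ a i j > t for all i}` is, since `A κ = 1`, the event that the vector `Y`
with `Y j = X j / t ^ κ j` lies in `M A`. Its coordinates with `κ j = 0` do not depend on `t`. For a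
coordinate with `κ j > 0`, let `ν_t` be the law of `Y j` divided by `P (X j > t ^ κ j)`. On `(0, ∞)`
this is the image of Lebesgue measure under the tail quantile function `Q_t` of `ν_t`
(`map_tailQuantile`). Thus the quotient in the theorem is the measure, under Lebesgue measure times
the law of the remaining `X j`, of the set of all `(u, z)` with `(Q_t u, z) ∈ M A`
(`prob_powerProd_gt`), the map `Q_t` acting on each coordinate of `u`. Regular variation says that
`Q_t u → u⁻¹` for every `u > 0`, and the boundary of `M A` is a null set because every row of `A` has
a non-zero entry in a column with `κ j > 0`. So the indicators of these sets converge almost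
everywhere to that of `(u⁻¹, z) ∈ M A`, and the substitution `x = u⁻¹` identifies the limit with the
integral of `∏ x_j⁻²` over `M A` (`setLIntegral_lebesgueProdLaw`).

It remains to find an integrable majorant (`exists_integrable_majorant`). In logarithmic coordinates
`s = log x`, a point of `M A` satisfies `A s > 0`, with `s j ≥ 0` where `κ j = 0`: it is a feasible
direction of the linear program at `κ`. As `κ` is the unique optimum, the objective `∑ s j` is
positive on the cone of these directions, hence by compactness it dominates `δ ∑ |s j|` for some
`δ > 0` (`IsUniqueOptimal.exists_mul_sum_abs_le`). Combined with the Potter bounds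
(`exists_potter_bound`, `RegularlyVarying.exists_log_le`), which compare `Q_t u` with `u⁻¹` up to a
small power, this bounds the indicators by a multiple of
`∏ u_j⁻¹ exp (-δ |log u_j| / 3) * ∏ z_j ^ (1 - δ)`, which is integrable by the moment assumption. -/

namespace PowerProducts

/-! ### The linear program -/

section LinearProgram

variable {n m : ℕ} {A : Matrix (Fin n) (Fin m) ℝ} {κ : Fin m → ℝ}

/-- Along a direction `s` of the cone, `κ + ε s` is feasible for small `ε > 0`, so by uniqueness
of `κ` it has a larger objective value. -/
lemma IsUniqueOptimal.sum_pos (hκ : IsUniqueOptimal A κ) {s : Fin m → ℝ} (hs0 : s ≠ 0)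
    (hs : ∀ i, 0 ≤ (A *ᵥ s) i) (hs' : ∀ j, ¬ 0 < κ j → 0 ≤ s j) : 0 < ∑ j, s j := by
  have hev : ∀ᶠ ε : ℝ in 𝓝[>] 0, ∀ j, 0 ≤ κ j + ε * s j := by
    refine eventually_all.2 fun j => ?_
    by_cases hj : 0 < κ j
    · have hc : Tendsto (fun ε : ℝ => κ j + ε * s j) (𝓝 0) (𝓝 (κ j + 0 * s j)) :=
        Continuous.tendsto (by fun_prop) 0
      have hc' := hc.mono_left (nhdsWithin_le_nhds (s := Set.Ioi 0))
      simp only [zero_mul, add_zero] at hc'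
      filter_upwards [hc'.eventually (lt_mem_nhds hj)] with ε hε using hε.le
    · filter_upwards [self_mem_nhdsWithin] with ε hε
      have hε' : (0 : ℝ) < ε := hε
      exact add_nonneg (hκ.1.1.1 j) (mul_nonneg hε'.le (hs' j hj))
  obtain ⟨ε, hε, hε0⟩ := (hev.and self_mem_nhdsWithin).exists
  have hε0 : 0 < ε := hε0
  have hfeas : IsFeasible A (κ + ε • s) := by
    refine ⟨fun j => by simpa using hε j, fun i => ?_⟩
    rw [Matrix.mulVec_add, Matrix.mulVec_smul]
    have h1 := hκ.1.1.2 i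
    have h2 := mul_nonneg hε0.le (hs i)
    simp only [Pi.add_apply, Pi.smul_apply, smul_eq_mul]
    linarith
  have hsum : ∑ j, (κ + ε • s) j = ∑ j, κ j + ε * ∑ j, s j := by
    simp [Finset.sum_add_distrib, Finset.mul_sum]
  by_contra! hle
  have hopt : IsOptimal A (κ + ε • s) := by
    refine ⟨hfeas, fun y hy => ?_⟩
    rw [hsum]
    have := hκ.1.2 y hy
    have := mul_nonpos_of_nonneg_of_nonpos hε0.le hle
    linarith
  have hEq := hκ.2 _ hopt
  apply hs0
  have : ε • s = 0 := by simpa using hEq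
  exact (smul_eq_zero.1 this).resolve_left hε0.ne'

/-- Quantitative form of uniqueness: on the cone of feasible directions at `κ`, the objective
dominates a multiple of the `ℓ¹`-norm. -/
lemma IsUniqueOptimal.exists_mul_sum_abs_le (hκ : IsUniqueOptimal A κ) :
    ∃ δ : ℝ, 0 < δ ∧ δ < 1 ∧ ∀ s : Fin m → ℝ, (∀ i, 0 ≤ (A *ᵥ s) i) →
      (∀ j, ¬ 0 < κ j → 0 ≤ s j) → δ * ∑ j, |s j| ≤ ∑ j, s j := by
  set C : Set (Fin m → ℝ) :=
    {s | (∀ i, 0 ≤ (A *ᵥ s) i) ∧ (∀ j, ¬ 0 < κ j → 0 ≤ s j) ∧ ∑ j, |s j| = 1} with hC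
  have hcl : IsClosed C := by
    have h1 : IsClosed {s : Fin m → ℝ | ∀ i, 0 ≤ (A *ᵥ s) i} := by
      simp only [Set.ofPred_forall]
      refine isClosed_iInter fun i => isClosed_le continuous_const ?_
      exact (continuous_apply i).comp (Continuous.matrix_mulVec continuous_const continuous_id)
    have h2 : IsClosed {s : Fin m → ℝ | ∀ j, ¬ 0 < κ j → 0 ≤ s j} := by
      simp only [Set.ofPred_forall]
      exact isClosed_iInter fun j => isClosed_iInter fun _ =>
        isClosed_le continuous_const (continuous_apply j)
    have h3 : IsClosed {s : Fin m → ℝ | ∑ j, |s j| = 1} :=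
      isClosed_eq (by fun_prop) continuous_const
    exact h1.inter (h2.inter h3)
  have hcomp : IsCompact C := by
    refine Metric.isCompact_of_isClosed_isBounded hcl
      ((Metric.isBounded_closedBall (x := (0 : Fin m → ℝ)) (r := 1)).subset fun s hs => ?_)
    rw [mem_closedBall_zero_iff, pi_norm_le_iff_of_nonneg zero_le_one]
    intro j
    rw [Real.norm_eq_abs, ← hs.2.2]
    exact Finset.single_le_sum (f := fun j => |s j|) (fun _ _ => abs_nonneg _) (Finset.mem_univ j)
  have hmin : ∃ c : ℝ, 0 < c ∧ ∀ s ∈ C, c ≤ ∑ j, s j := by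
    rcases C.eq_empty_or_nonempty with hE | hN
    · exact ⟨1, one_pos, by simp [hE]⟩
    · obtain ⟨s, hs, hsm⟩ := hcomp.exists_isMinOn hN
        (f := fun s : Fin m → ℝ => ∑ j, s j) (by fun_prop)
      refine ⟨∑ j, s j, hκ.sum_pos ?_ hs.1 hs.2.1, fun t ht => hsm ht⟩
      rintro rfl
      simpa using hs.2.2
  obtain ⟨c, hc, hcC⟩ := hmin
  refine ⟨min c (1 / 2), by positivity, by
    have := min_le_right c (1 / 2 : ℝ); linarith, fun s hs hs' => ?_⟩
  set N := ∑ j, |s j| with hN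
  have hN0 : 0 ≤ N := Finset.sum_nonneg fun _ _ => abs_nonneg _
  rcases hN0.eq_or_lt with h0 | hpos
  · have hz : ∀ j, s j = 0 := by
      intro j
      have := (Finset.sum_eq_zero_iff_of_nonneg (fun j _ => abs_nonneg (s j))).1 h0.symm j
        (Finset.mem_univ j)
      simpa using this
    rw [← h0]
    simp [hz]
  · have hmem : N⁻¹ • s ∈ C := by
      refine ⟨fun i => ?_, fun j hj => ?_, ?_⟩
      · rw [Matrix.mulVec_smul]
        exact mul_nonneg (inv_nonneg.2 hN0) (hs i)
      · exact mul_nonneg (inv_nonneg.2 hN0) (hs' j hj)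
      · simp only [Pi.smul_apply, smul_eq_mul, abs_mul, abs_of_nonneg (inv_nonneg.2 hN0),
          ← Finset.mul_sum]
        exact inv_mul_cancel₀ hpos.ne'
    have h := hcC _ hmem
    simp only [Pi.smul_apply, smul_eq_mul, ← Finset.mul_sum] at h
    calc min c (1 / 2) * N ≤ c * N := by gcongr; exact min_le_left _ _
      _ ≤ (N⁻¹ * ∑ j, s j) * N := by gcongr
      _ = ∑ j, s j := by field_simp

/-- Otherwise lowering `κ j` to `0` would keep `κ` feasible. -/
lemma IsOptimal.exists_entry_pos (hκ : IsOptimal A κ) {j : Fin m} (hj : 0 < κ j) :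
    ∃ i, 0 < A i j := by
  by_contra! hle
  have hsum : ∑ k, Function.update κ j 0 k = ∑ k, κ k - κ j := by
    rw [Finset.sum_update_of_mem (Finset.mem_univ j),
      ← Finset.add_sum_erase _ _ (Finset.mem_univ j), Finset.sdiff_singleton_eq_erase]
    ring
  have hfeas : IsFeasible A (Function.update κ j 0) := by
    refine ⟨fun k => ?_, fun i => (hκ.1.2 i).trans ?_⟩
    · by_cases hk : k = j
      · subst hk; simp
      · simpa [hk] using hκ.1.1 k
    · simp only [Matrix.mulVec, dotProduct]
      refine Finset.sum_le_sum fun k _ => ?_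
      by_cases hk : k = j
      · subst hk
        simpa using mul_nonpos_of_nonpos_of_nonneg (hle i) hj.le
      · simp [hk]
  have := hκ.2 _ hfeas
  linarith

/-- The set of `j` with `κ j > 0` meets the support of every row of `A`. -/
lemma exists_entry_ne_zero (hκ : IsFeasible A κ) (i : Fin n) :
    ∃ j, 0 < κ j ∧ A i j ≠ 0 := by
  by_contra! h
  have h1 : (A *ᵥ κ) i = 0 := by
    simp only [Matrix.mulVec, dotProduct]
    refine Finset.sum_eq_zero fun j _ => ?_
    by_cases hj : 0 < κ j
    · rw [h j hj, zero_mul]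
    · rw [le_antisymm (not_lt.1 hj) (hκ.1 j), mul_zero]
  have := hκ.2 i
  linarith

end LinearProgram

/-! ### Power products -/

section PowerProd

variable {n m : ℕ} (A : Matrix (Fin n) (Fin m) ℝ)

lemma measurable_powerProd (i : Fin n) : Measurable fun x => powerProd A x i := by
  unfold powerProd
  fun_prop

lemma measurableSet_M : MeasurableSet (M A) := by
  have h1 : MeasurableSet {x : Fin m → ℝ | ∀ j, 0 ≤ x j} := by
    simp only [Set.ofPred_forall]
    exact MeasurableSet.iInter fun j => measurableSet_le measurable_const (measurable_pi_apply j)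
  have h2 : MeasurableSet {x : Fin m → ℝ | ∀ i, 1 < powerProd A x i} := by
    simp only [Set.ofPred_forall]
    exact MeasurableSet.iInter fun i => measurableSet_lt measurable_const (measurable_powerProd A i)
  exact h1.inter h2

lemma powerProd_of_pos {x : Fin m → ℝ} (hx : ∀ j, 0 < x j) (i : Fin n) :
    powerProd A x i = ENNReal.ofReal (Real.exp ((A *ᵥ fun j => Real.log (x j)) i)) := by
  simp only [powerProd, Matrix.mulVec, dotProduct]
  rw [Real.exp_sum, ENNReal.ofReal_prod_of_nonneg fun _ _ => (Real.exp_pos _).le]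
  refine Finset.prod_congr rfl fun j _ => ?_
  rw [ENNReal.ofReal_rpow_of_pos (hx j), Real.rpow_def_of_pos (hx j), mul_comm]

lemma one_lt_powerProd_iff {x : Fin m → ℝ} (hx : ∀ j, 0 < x j) (i : Fin n) :
    1 < powerProd A x i ↔ 0 < (A *ᵥ fun j => Real.log (x j)) i := by
  rw [powerProd_of_pos A hx, ENNReal.one_lt_ofReal, Real.one_lt_exp_iff]

lemma mem_M_iff_of_pos {x : Fin m → ℝ} (hx : ∀ j, 0 < x j) :
    x ∈ M A ↔ ∀ i, 0 < (A *ᵥ fun j => Real.log (x j)) i := by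
  simp only [M, Set.mem_ofPred_eq, one_lt_powerProd_iff A hx]
  exact ⟨fun h => h.2, fun h => ⟨fun j => (hx j).le, h⟩⟩

variable {A}

/-- A vanishing coordinate `j` with `κ j > 0` makes some power product vanish, even if other
factors of it are infinite. -/
lemma pos_of_mem_M {κ : Fin m → ℝ} (hκ : IsOptimal A κ) {x : Fin m → ℝ} (hx : x ∈ M A)
    {j : Fin m} (hj : 0 < κ j) : 0 < x j := by
  refine lt_of_le_of_ne (hx.1 j) fun h0 => ?_
  obtain ⟨i, hi⟩ := hκ.exists_entry_pos hj
  have hz : powerProd A x i = 0 :=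
    Finset.prod_eq_zero (Finset.mem_univ j) (by simp [← h0, hi])
  have := hx.2 i
  simp [hz] at this

/-- Rescaling the coordinates by `t ^ κ j` multiplies each power product by `t ^ (A κ)ᵢ = t`. -/
lemma lt_powerProd_iff {κ : Fin m → ℝ} (hAκ : ∀ i, (A *ᵥ κ) i = 1) {t : ℝ} (ht : 0 < t)
    (x : Fin m → ℝ) (i : Fin n) :
    ENNReal.ofReal t < powerProd A x i ↔ 1 < powerProd A (fun j => x j / t ^ κ j) i := by
  have hpos : ∀ j, 0 < t ^ κ j := fun j => Real.rpow_pos_of_pos ht _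
  have hscale : powerProd A x i =
      ENNReal.ofReal t * powerProd A (fun j => x j / t ^ κ j) i := by
    have h1 : ∀ j, ENNReal.ofReal (x j) ^ A i j =
        ENNReal.ofReal (t ^ κ j) ^ A i j * ENNReal.ofReal (x j / t ^ κ j) ^ A i j := by
      intro j
      rw [← ENNReal.mul_rpow_of_ne_top ENNReal.ofReal_ne_top ENNReal.ofReal_ne_top,
        ← ENNReal.ofReal_mul (hpos j).le, mul_div_cancel₀ _ (hpos j).ne']
    have h2 : ∏ j, ENNReal.ofReal (t ^ κ j) ^ A i j = ENNReal.ofReal t := by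
      have h3 : ∀ j, ENNReal.ofReal (t ^ κ j) ^ A i j = ENNReal.ofReal (t ^ (A i j * κ j)) := by
        intro j
        rw [ENNReal.ofReal_rpow_of_pos (hpos j), ← Real.rpow_mul ht.le, mul_comm]
      simp only [h3]
      rw [← ENNReal.ofReal_prod_of_nonneg fun _ _ => (Real.rpow_pos_of_pos ht _).le,
        ← Real.rpow_sum_of_pos ht]
      have : ∑ j, A i j * κ j = 1 := hAκ i
      rw [this, Real.rpow_one]
    simp only [powerProd]
    rw [Finset.prod_congr rfl fun j _ => h1 j, Finset.prod_mul_distrib, h2]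
  rw [hscale]
  have ht0 : ENNReal.ofReal t ≠ 0 := by simpa using ht
  conv_lhs => rw [← mul_one (ENNReal.ofReal t)]
  rw [mul_assoc, one_mul, ENNReal.mul_lt_mul_iff_right ht0 ENNReal.ofReal_ne_top]

end PowerProd

/-! ### Potter bounds -/

/-- A global form of the Potter bounds for a regularly varying survival function `F` of index
`-1`: besides `y * t` large, all small positive `y` are allowed. -/
lemma exists_potter_bound {F : ℝ → ℝ} (hF : Antitone F) (hF1 : ∀ t, F t ≤ 1)
    (hpos : ∀ᶠ t in atTop, 0 < F t)
    (hlim : Tendsto (fun t => F (2 * t) / F t) atTop (𝓝 (2 ^ (-1 : ℝ))))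
    {η : ℝ} (hη : 0 < η) (hη1 : η < 1) :
    ∃ K : ℝ, 0 < K ∧ ∀ᶠ t in atTop, ∀ y, 0 < y →
      F (y * t) / F t ≤ K * Real.exp (-Real.log y + η * |Real.log y|) := by
  have hl2 : 0 < Real.log 2 := Real.log_pos one_lt_two
  have hexp : ∀ a : ℝ, (2 : ℝ) ^ a = Real.exp (Real.log 2 * a) := fun a =>
    Real.rpow_def_of_pos two_pos a
  have hup : ∀ᶠ t in atTop, F (2 * t) / F t < Real.exp (Real.log 2 * (-1 + η)) := by
    refine hlim.eventually (gt_mem_nhds ?_)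
    rw [hexp, Real.exp_lt_exp]
    nlinarith
  have hlow : ∀ᶠ t in atTop, Real.exp (Real.log 2 * (-1 - η)) < F (2 * t) / F t := by
    refine hlim.eventually (lt_mem_nhds ?_)
    rw [hexp, Real.exp_lt_exp]
    nlinarith
  obtain ⟨t₀, ht₀⟩ := eventually_atTop.1 (hpos.and (hup.and (hlow.and (eventually_gt_atTop 0))))
  have h0 : 0 < t₀ := (ht₀ t₀ le_rfl).2.2.2
  -- Iterating the bounds for `F (2 * t) / F t` controls `F` along the powers of two; monotonicity
  -- interpolates at the cost of a constant.
  have hupk : ∀ (k : ℕ) (t : ℝ), t₀ ≤ t →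
      F (2 ^ k * t) ≤ Real.exp (k * (Real.log 2 * (-1 + η))) * F t := by
    intro k
    induction k with
    | zero => intro t _; simp
    | succ k ih =>
      intro t ht
      have ht' : t₀ ≤ 2 * t := by linarith
      have h1 := ih (2 * t) ht'
      have h2 := ((div_lt_iff₀ (ht₀ t ht).1).1 (ht₀ t ht).2.1).le
      calc F (2 ^ (k + 1) * t) = F (2 ^ k * (2 * t)) := by ring_nf
        _ ≤ Real.exp (k * (Real.log 2 * (-1 + η))) * F (2 * t) := h1
        _ ≤ Real.exp (k * (Real.log 2 * (-1 + η))) * (Real.exp (Real.log 2 * (-1 + η)) * F t) := by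
            gcongr
        _ = _ := by rw [← mul_assoc, ← Real.exp_add]; push_cast; ring_nf
  have hlowk : ∀ (k : ℕ) (t : ℝ), t₀ ≤ t →
      F t ≤ Real.exp (k * (Real.log 2 * (1 + η))) * F (2 ^ k * t) := by
    intro k
    induction k with
    | zero => intro t _; simp
    | succ k ih =>
      intro t ht
      have ht' : t₀ ≤ 2 * t := by linarith
      have h1 := ih (2 * t) ht'
      have h2 := ((lt_div_iff₀ (ht₀ t ht).1).1 (ht₀ t ht).2.2.1).le
      calc F t = Real.exp (Real.log 2 * (1 + η)) * (Real.exp (Real.log 2 * (-1 - η)) * F t) := by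
            rw [← mul_assoc, ← Real.exp_add]
            ring_nf
            simp
        _ ≤ Real.exp (Real.log 2 * (1 + η)) * F (2 * t) := by gcongr
        _ ≤ Real.exp (Real.log 2 * (1 + η)) *
            (Real.exp (k * (Real.log 2 * (1 + η))) * F (2 ^ k * (2 * t))) := by gcongr
        _ = _ := by
            rw [← mul_assoc, ← Real.exp_add, show (2 : ℝ) ^ k * (2 * t) = 2 ^ (k + 1) * t by ring]
            push_cast
            ring_nf
  have hlog_le : ∀ (w : ℝ) (k : ℕ), 0 < w → w < 2 ^ (k + 1) →
      Real.log w ≤ (k + 1) * Real.log 2 := by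
    intro w k hw h
    have := Real.log_le_log hw h.le
    rw [Real.log_pow] at this
    exact_mod_cast this
  have hle_log : ∀ (w : ℝ) (k : ℕ), 2 ^ k ≤ w → k * Real.log 2 ≤ Real.log w := by
    intro w k h
    have := Real.log_le_log (by positivity) h
    rwa [Real.log_pow] at this
  -- For `y < 1` this is applied with `w = y⁻¹` at `y * t`, or at `t₀` if `y * t < t₀`: there the
  -- trivial bound `F (y * t) ≤ 1` is a multiple of `F t₀`.
  have hlow' : ∀ (t w : ℝ), t₀ ≤ t → 1 ≤ w →
      F t ≤ 4 * Real.exp ((1 + η) * Real.log w) * F (w * t) := by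
    intro t w ht hw
    obtain ⟨k, hk1, hk2⟩ := exists_nat_pow_near hw one_lt_two
    have hFw : 0 ≤ F (w * t) := (ht₀ _ (by nlinarith)).1.le
    have h1 : F (2 ^ (k + 1) * t) ≤ F (w * t) := hF (by
      have : 0 < t := h0.trans_le ht
      gcongr)
    have h2 := hle_log w k hk1
    calc F t ≤ Real.exp ((k + 1 : ℕ) * (Real.log 2 * (1 + η))) * F (2 ^ (k + 1) * t) :=
          hlowk (k + 1) t ht
      _ ≤ Real.exp ((k + 1 : ℕ) * (Real.log 2 * (1 + η))) * F (w * t) := by gcongr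
      _ ≤ (4 * Real.exp ((1 + η) * Real.log w)) * F (w * t) := by
          gcongr
          have h4 : (4 : ℝ) = Real.exp (2 * Real.log 2) := by
            rw [← Real.log_rpow two_pos, Real.exp_log (by positivity)]; norm_num
          rw [h4, ← Real.exp_add, Real.exp_le_exp]
          push_cast
          nlinarith
  have hF0 := (ht₀ t₀ le_rfl).1
  have hK1 : (4 : ℝ) ≤ 4 / F t₀ := by
    rw [le_div_iff₀ hF0]
    have := hF1 t₀
    linarith
  refine ⟨4 / F t₀, by positivity, eventually_atTop.2 ⟨t₀, fun t ht y hy => ?_⟩⟩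
  have htpos : 0 < t := h0.trans_le ht
  have hFt := (ht₀ t ht).1
  rw [div_le_iff₀ hFt]
  rcases le_or_gt 1 y with h1 | h1
  · rw [abs_of_nonneg (Real.log_nonneg h1)]
    obtain ⟨k, hk1, hk2⟩ := exists_nat_pow_near h1 one_lt_two
    have h2 := hlog_le y k hy hk2
    calc F (y * t) ≤ F (2 ^ k * t) := hF (by gcongr)
      _ ≤ Real.exp (k * (Real.log 2 * (-1 + η))) * F t := hupk k t ht
      _ ≤ (4 * Real.exp (-Real.log y + η * Real.log y)) * F t := by
          gcongr
          have h4 : Real.exp (1 * Real.log 2) ≤ 4 := by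
            rw [one_mul, Real.exp_log two_pos]; norm_num
          refine le_trans ?_ (mul_le_mul_of_nonneg_right h4 (Real.exp_pos _).le)
          rw [← Real.exp_add, Real.exp_le_exp]
          nlinarith
      _ ≤ _ := by gcongr
  · rw [abs_of_neg (Real.log_neg hy h1)]
    have hy1 : 1 ≤ y⁻¹ := (one_le_inv₀ hy).2 h1.le
    have hrw : -Real.log y + η * -Real.log y = (1 + η) * Real.log y⁻¹ := by
      rw [Real.log_inv]; ring
    rw [hrw]
    rcases le_or_gt t₀ (y * t) with h2 | h2
    · have := hlow' (y * t) y⁻¹ h2 hy1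
      rw [inv_mul_cancel_left₀ hy.ne'] at this
      refine this.trans ?_
      gcongr
    · have hw : 1 ≤ t / t₀ := (one_le_div h0).2 ht
      have h3 := hlow' t₀ (t / t₀) le_rfl hw
      rw [div_mul_cancel₀ _ h0.ne'] at h3
      have h4 : Real.log (t / t₀) ≤ Real.log y⁻¹ := by
        refine Real.log_le_log (by positivity) ?_
        rw [div_le_iff₀ h0, ← div_eq_inv_mul, le_div_iff₀ hy]
        linarith
      calc F (y * t) ≤ 1 := hF1 _
        _ = F t₀ / F t₀ := (div_self hF0.ne').symm
        _ ≤ (4 * Real.exp ((1 + η) * Real.log (t / t₀)) * F t) / F t₀ := by gcongr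
        _ ≤ (4 * Real.exp ((1 + η) * Real.log y⁻¹) * F t) / F t₀ := by gcongr
        _ = _ := by ring

/-! ### Tail quantile functions -/

section TailQuantile

/-- The generalized inverse of the tail `y ↦ ν (y, ∞)`, restricted to `y ≥ 0`. It vanishes for
`u ≤ 0`, and for those `u > 0` which the tail does not exceed on `[0, ∞)`, as `sSup ∅ = 0`. -/
noncomputable def tailQuantile (ν : Measure ℝ) (u : ℝ) : ℝ :=
  sSup {y | 0 < u ∧ 0 ≤ y ∧ u < ν.real (Set.Ioi y)}

variable (ν : Measure ℝ)

lemma tailQuantile_nonneg (u : ℝ) : 0 ≤ tailQuantile ν u :=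
  Real.sSup_nonneg fun _ hy => hy.2.1

lemma preimage_tailQuantile_Ioi_of_neg {y : ℝ} (hy : y < 0) :
    tailQuantile ν ⁻¹' Set.Ioi y = Set.univ :=
  Set.eq_univ_of_forall fun u => hy.trans_le (tailQuantile_nonneg ν u)

variable [IsFiniteMeasure ν]

lemma tendsto_real_Ioi_atTop : Tendsto (fun y : ℝ => ν.real (Set.Ioi y)) atTop (𝓝 0) := by
  have h : ∀ y : ℝ, ν.real (Set.Ioi y) = ν.real Set.univ - ν.real (Set.Iic y) := by
    intro y
    rw [← Set.compl_Iic, measureReal_compl measurableSet_Iic]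
  simp only [h]
  have h1 : Tendsto (fun y : ℝ => ν.real (Set.Iic y)) atTop (𝓝 (ν.real Set.univ)) :=
    (ENNReal.tendsto_toReal (measure_ne_top ν _)).comp (tendsto_measure_Iic_atTop ν)
  simpa using (tendsto_const_nhds (x := ν.real Set.univ)).sub h1

lemma exists_gt_lt_real_Ioi {u y : ℝ} (h : u < ν.real (Set.Ioi y)) :
    ∃ z, y < z ∧ u < ν.real (Set.Ioi z) := by
  have hU : Set.Ioi y = ⋃ k : ℕ, Set.Ioi (y + 1 / ((k : ℝ) + 1)) := by
    ext z
    simp only [Set.mem_Ioi, Set.mem_iUnion]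
    constructor
    · intro hz
      obtain ⟨k, hk⟩ := exists_nat_one_div_lt (sub_pos.2 hz)
      exact ⟨k, by linarith⟩
    · rintro ⟨k, hk⟩
      have : 0 < 1 / ((k : ℝ) + 1) := by positivity
      linarith
  have hmono : Monotone fun k : ℕ => Set.Ioi (y + 1 / ((k : ℝ) + 1)) := by
    intro a b hab
    refine Set.Ioi_subset_Ioi ?_
    gcongr
  have ht := tendsto_measure_iUnion_atTop (μ := ν) hmono
  rw [← hU] at ht
  have ht' := (ENNReal.tendsto_toReal (measure_ne_top ν _)).comp ht
  obtain ⟨k, hk⟩ := (ht'.eventually (lt_mem_nhds h)).exists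
  exact ⟨_, by have : 0 < 1 / ((k : ℝ) + 1) := by positivity
               linarith, hk⟩

lemma lt_tailQuantile_iff {u y : ℝ} (hy : 0 ≤ y) :
    y < tailQuantile ν u ↔ 0 < u ∧ u < ν.real (Set.Ioi y) := by
  constructor
  · intro h
    have hne : {y | 0 < u ∧ 0 ≤ y ∧ u < ν.real (Set.Ioi y)}.Nonempty := by
      by_contra hE
      rw [Set.not_nonempty_iff_eq_empty] at hE
      rw [tailQuantile, hE, Real.sSup_empty] at h
      linarith
    obtain ⟨z, ⟨hu, -, hz⟩, hyz⟩ := exists_lt_of_lt_csSup hne h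
    exact ⟨hu, hz.trans_le (measureReal_mono (Set.Ioi_subset_Ioi hyz.le))⟩
  · rintro ⟨hu, h⟩
    obtain ⟨z, hyz, hz⟩ := exists_gt_lt_real_Ioi ν h
    refine hyz.trans_le (le_csSup ?_ ⟨hu, hy.trans hyz.le, hz⟩)
    obtain ⟨b, hb⟩ := ((tendsto_real_Ioi_atTop ν).eventually (gt_mem_nhds hu)).exists
    refine ⟨b, fun w hw => ?_⟩
    by_contra! hbw
    exact (hw.2.2.trans_le (measureReal_mono (Set.Ioi_subset_Ioi hbw.le))).not_gt hb

lemma preimage_tailQuantile_Ioi {y : ℝ} (hy : 0 ≤ y) :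
    tailQuantile ν ⁻¹' Set.Ioi y = Set.Ioo 0 (ν.real (Set.Ioi y)) := by
  ext u
  exact lt_tailQuantile_iff ν hy

lemma measurable_tailQuantile : Measurable (tailQuantile ν) := by
  refine measurable_of_Ioi fun y => ?_
  rcases le_or_gt 0 y with hy | hy
  · rw [preimage_tailQuantile_Ioi ν hy]
    exact measurableSet_Ioo
  · rw [preimage_tailQuantile_Ioi_of_neg ν hy]
    exact MeasurableSet.univ

/-- The quantile transformation: `ν` on `(0, ∞)` is an image of Lebesgue measure. -/
lemma map_tailQuantile :
    (volume.restrict (Set.Ioo 0 (ν.real (Set.Ioi 0)))).map (tailQuantile ν) =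
      ν.restrict (Set.Ioi 0) := by
  have hvol : ∀ y : ℝ, volume (Set.Ioo 0 (ν.real (Set.Ioi y))) = ν (Set.Ioi y) := by
    intro y
    rw [Real.volume_Ioo, sub_zero, ofReal_measureReal]
  have hIoi : ∀ y : ℝ, (volume.restrict (Set.Ioo 0 (ν.real (Set.Ioi 0)))).map (tailQuantile ν)
      (Set.Ioi y) = ν.restrict (Set.Ioi 0) (Set.Ioi y) := by
    intro y
    rw [Measure.map_apply (measurable_tailQuantile ν) measurableSet_Ioi,
      Measure.restrict_apply (measurable_tailQuantile ν measurableSet_Ioi),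
      Measure.restrict_apply measurableSet_Ioi]
    rcases le_or_gt 0 y with hy | hy
    · rw [preimage_tailQuantile_Ioi ν hy, Set.inter_eq_left.2, Set.inter_eq_left.2, hvol]
      · exact Set.Ioi_subset_Ioi hy
      · exact Set.Ioo_subset_Ioo_right (measureReal_mono (Set.Ioi_subset_Ioi hy))
    · rw [preimage_tailQuantile_Ioi_of_neg ν hy, Set.univ_inter, Set.inter_eq_right.2, hvol]
      exact Set.Ioi_subset_Ioi hy.le
  refine ext_of_generate_finite _ (borel_eq_generateFrom_Ioi ℝ ▸ BorelSpace.measurable_eq)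
    isPiSystem_Ioi ?_ ?_
  · rintro _ ⟨y, rfl⟩
    exact hIoi y
  · rw [Measure.map_apply (measurable_tailQuantile ν) MeasurableSet.univ]
    simp [hvol]

end TailQuantile

/-! ### The rescaled law of a regularly varying random variable -/

section TailLaw

variable {Ω : Type*} [MeasurableSpace Ω] (P : Measure Ω) (X : Ω → ℝ)

/-- The law of `X / t`, normalized to give mass one to `(1, ∞)`. The normalization is meaningful only
if `P (X > t) ≠ 0`; otherwise the factor is `0⁻¹ = ∞`. -/
noncomputable def tailLaw (t : ℝ) : Measure ℝ :=
  (P {ω | t < X ω})⁻¹ • P.map fun ω => X ω / t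

variable {P X}

lemma tailLaw_real_Ioi (hX : Measurable X) {t : ℝ} (ht : 0 < t) (y : ℝ) :
    (tailLaw P X t).real (Set.Ioi y) = P.real {ω | y * t < X ω} / P.real {ω | t < X ω} := by
  have hset : (fun ω => X ω / t) ⁻¹' Set.Ioi y = {ω | y * t < X ω} := by
    ext ω
    exact lt_div_iff₀ ht
  rw [tailLaw, measureReal_ennreal_smul_apply, ENNReal.toReal_inv, measureReal_def,
    Measure.map_apply (hX.div_const t) measurableSet_Ioi, hset, div_eq_inv_mul,
    measureReal_def, measureReal_def]

lemma isFiniteMeasure_tailLaw [IsFiniteMeasure P] {t : ℝ} (hp : P {ω | t < X ω} ≠ 0) :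
    IsFiniteMeasure (tailLaw P X t) :=
  Measure.smul_finite _ (ENNReal.inv_ne_top.2 hp)

lemma map_div_eq_smul_tailLaw [IsFiniteMeasure P] {t : ℝ} (hp : P {ω | t < X ω} ≠ 0) :
    P.map (fun ω => X ω / t) = P {ω | t < X ω} • tailLaw P X t := by
  rw [tailLaw, smul_smul, ENNReal.mul_inv_cancel hp (measure_ne_top _ _), one_smul]

lemma RegularlyVarying.eventually_ne_zero {ρ : ℝ} (h : RegularlyVarying P X ρ) :
    ∀ᶠ t in atTop, P {ω | t < X ω} ≠ 0 := by
  filter_upwards [h.1] with t ht h0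
  simp [measureReal_def, h0] at ht

variable [IsProbabilityMeasure P]

lemma RegularlyVarying.tendsto_tailQuantile (h : RegularlyVarying P X (-1)) (hX : Measurable X)
    {u : ℝ} (hu : 0 < u) :
    Tendsto (fun t => tailQuantile (tailLaw P X t) u) atTop (𝓝 u⁻¹) := by
  have hui : 0 < u⁻¹ := inv_pos.2 hu
  have hr : ∀ b : ℝ, 0 < b → Tendsto (fun t => (tailLaw P X t).real (Set.Ioi b)) atTop (𝓝 b⁻¹) := by
    intro b hb
    have := h.2 b hb
    rw [Real.rpow_neg_one] at this
    refine this.congr' ?_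
    filter_upwards [eventually_gt_atTop 0] with t ht
    rw [tailLaw_real_Ioi hX ht]
  refine tendsto_order.2 ⟨fun a ha => ?_, fun a ha => ?_⟩
  · obtain ⟨b, hb, hbu⟩ := exists_between (max_lt ha hui)
    have hb0 : 0 < b := (le_max_right _ _).trans_lt hb
    have hub : u < b⁻¹ := by rwa [lt_inv_comm₀ hu hb0]
    filter_upwards [(hr b hb0).eventually (lt_mem_nhds hub), h.eventually_ne_zero] with t ht hp
    have := isFiniteMeasure_tailLaw hp
    exact ((le_max_left _ _).trans_lt hb).trans
      ((lt_tailQuantile_iff _ hb0.le).2 ⟨hu, ht⟩)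
  · obtain ⟨b, hub, hba⟩ := exists_between ha
    have hb0 : 0 < b := hui.trans hub
    have hbu : b⁻¹ < u := by rwa [inv_lt_comm₀ hb0 hu]
    filter_upwards [(hr b hb0).eventually (gt_mem_nhds hbu), h.eventually_ne_zero] with t ht hp
    have := isFiniteMeasure_tailLaw hp
    refine lt_of_le_of_lt (not_lt.1 fun hlt => ?_) hba
    exact ((lt_tailQuantile_iff _ hb0.le).1 hlt).2.not_gt ht

/-- The Potter bounds, in terms of the tail quantile function. -/
lemma RegularlyVarying.exists_log_le (h : RegularlyVarying P X (-1)) (hX : Measurable X)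
    {η : ℝ} (hη : 0 < η) (hη1 : η < 1) :
    ∃ K : ℝ, ∀ᶠ t in atTop, ∀ u, 0 < tailQuantile (tailLaw P X t) u →
      0 < u ∧ Real.log u ≤ K - Real.log (tailQuantile (tailLaw P X t) u) +
        η * |Real.log (tailQuantile (tailLaw P X t) u)| := by
  obtain ⟨K, hK0, hK⟩ := exists_potter_bound (F := fun t => P.real {ω | t < X ω})
    (fun a b hab => measureReal_mono fun ω (hω : b < X ω) => hab.trans_lt hω)
    (fun _ => measureReal_le_one) h.1 (h.2 2 two_pos) hη hη1
  refine ⟨Real.log K + 2 * Real.log 2, ?_⟩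
  filter_upwards [hK, eventually_gt_atTop 0, h.eventually_ne_zero] with t ht ht0 hp u hQ
  have := isFiniteMeasure_tailLaw hp
  set q := tailQuantile (tailLaw P X t) u with hq
  -- the tail at `q / 2 < q` exceeds `u`
  obtain ⟨hu, hlt⟩ := (lt_tailQuantile_iff (tailLaw P X t) (half_pos hQ).le).1 (half_lt_self hQ)
  refine ⟨hu, ?_⟩
  rw [tailLaw_real_Ioi hX ht0] at hlt
  have h1 := Real.log_le_log hu (hlt.le.trans (ht _ (half_pos hQ)))
  rw [Real.log_mul hK0.ne' (Real.exp_pos _).ne', Real.log_exp,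
    Real.log_div hQ.ne' two_ne_zero] at h1
  have hl2 : 0 < Real.log 2 := Real.log_pos one_lt_two
  have h2 : |Real.log q - Real.log 2| ≤ |Real.log q| + Real.log 2 := by
    simpa [abs_of_pos hl2] using abs_sub (Real.log q) (Real.log 2)
  nlinarith [mul_le_mul_of_nonneg_left h2 hη.le]

end TailLaw

/-! ### Product measures on a positive orthant -/

section Orthant

variable {ι : Type*} [Fintype ι]

lemma pi_apply_of_smul {μ ν : ι → Measure ℝ} [∀ i, IsFiniteMeasure (μ i)]
    [∀ i, IsFiniteMeasure (ν i)] {c : ι → ℝ≥0∞} (h : ∀ i, μ i = c i • ν i) (S : Set (ι → ℝ)) :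
    Measure.pi μ S = (∏ i, c i) * Measure.pi ν S := by
  have : Measure.pi μ = (∏ i, c i) • Measure.pi ν := by
    refine Measure.pi_eq fun s _ => ?_
    simp [h, Finset.prod_mul_distrib]
  rw [this, Measure.smul_apply, smul_eq_mul]

lemma pi_apply_eq_volume_tailQuantile (ν : ι → Measure ℝ) [∀ i, IsFiniteMeasure (ν i)]
    {S : Set (ι → ℝ)} (hS : MeasurableSet S) (hpos : ∀ y ∈ S, ∀ i, 0 < y i) :
    Measure.pi ν S = volume {u : ι → ℝ | (fun i => tailQuantile (ν i) (u i)) ∈ S} := by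
  have hTm : Measurable fun (u : ι → ℝ) i => tailQuantile (ν i) (u i) :=
    measurable_pi_lambda _ fun i => (measurable_tailQuantile (ν i)).comp (measurable_pi_apply i)
  have hbox : S ⊆ Set.univ.pi fun _ => Set.Ioi 0 := fun y hy i _ => hpos y hy i
  have hbox' : {u : ι → ℝ | (fun i => tailQuantile (ν i) (u i)) ∈ S} ⊆
      Set.univ.pi fun i => Set.Ioo 0 ((ν i).real (Set.Ioi 0)) :=
    fun u hu i _ => (lt_tailQuantile_iff (ν i) le_rfl).1 (hpos _ hu i)
  have hmap : ∀ i, (volume.restrict (Set.Ioo 0 ((ν i).real (Set.Ioi 0)))).map (tailQuantile (ν i)) =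
      (ν i).restrict (Set.Ioi 0) := fun i => map_tailQuantile (ν i)
  have hsf : ∀ i, SigmaFinite ((volume.restrict (Set.Ioo 0 ((ν i).real (Set.Ioi 0)))).map
      (tailQuantile (ν i))) := fun i => by rw [hmap]; infer_instance
  calc Measure.pi ν S = (Measure.pi ν).restrict (Set.univ.pi fun _ => Set.Ioi 0) S :=
        (Measure.restrict_eq_self _ hbox).symm
    _ = Measure.pi (fun i => (volume.restrict (Set.Ioo 0 ((ν i).real (Set.Ioi 0)))).map
          (tailQuantile (ν i))) S := by
        rw [Measure.restrict_pi_pi]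
        simp only [hmap]
    _ = (volume.restrict (Set.univ.pi fun i => Set.Ioo 0 ((ν i).real (Set.Ioi 0))))
          {u : ι → ℝ | (fun i => tailQuantile (ν i) (u i)) ∈ S} := by
        rw [← Measure.pi_map_pi fun i => (measurable_tailQuantile (ν i)).aemeasurable,
          Measure.map_apply hTm hS, volume_pi, Measure.restrict_pi_pi]
        rfl
    _ = _ := Measure.restrict_eq_self _ hbox'

/-- The change of variables `x ↦ x⁻¹`, coordinate by coordinate. -/
lemma setLIntegral_prod_zpow_neg_two {S : Set (ι → ℝ)} (hS : MeasurableSet S)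
    (hpos : ∀ y ∈ S, ∀ i, 0 < y i) :
    ∫⁻ x in S, ENNReal.ofReal (∏ i, x i ^ (-2 : ℤ)) =
      volume {u : ι → ℝ | (fun i => (u i)⁻¹) ∈ S} := by
  classical
  have himage : (fun (x : ι → ℝ) i => (x i)⁻¹) '' S = {u : ι → ℝ | (fun i => (u i)⁻¹) ∈ S} := by
    ext u
    constructor
    · rintro ⟨x, hx, rfl⟩
      simpa using hx
    · intro hu
      exact ⟨_, hu, by simp⟩
  have hder : ∀ x ∈ S, HasFDerivWithinAt (fun (x : ι → ℝ) i => (x i)⁻¹)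
      (ContinuousLinearMap.pi fun i =>
        (ContinuousLinearMap.toSpanSingleton ℝ (-(x i ^ 2)⁻¹)) ∘SL
          (ContinuousLinearMap.proj (R := ℝ) (φ := fun _ : ι => ℝ) i)) S x := by
    intro x hx
    refine HasFDerivAt.hasFDerivWithinAt (hasFDerivAt_pi.2 fun i => ?_)
    have h1 : HasFDerivAt (fun x : ℝ => x⁻¹) _ (x i) :=
      (hasDerivAt_inv (hpos x hx i).ne').hasFDerivAt
    exact h1.comp x (hasFDerivAt_apply i x)
  have hinj : Set.InjOn (fun (x : ι → ℝ) i => (x i)⁻¹) S := by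
    intro x _ y _ hxy
    ext i
    exact inv_injective (congrFun hxy i)
  have h := lintegral_image_eq_lintegral_abs_det_fderiv_mul volume hS hder hinj fun _ => 1
  rw [setLIntegral_one, himage] at h
  rw [h]
  refine setLIntegral_congr_fun hS fun x _ => ?_
  simp only [mul_one]
  congr 1
  rw [ContinuousLinearMap.det_pi, Finset.abs_prod]
  refine Finset.prod_congr rfl fun i _ => ?_
  have : (ContinuousLinearMap.toSpanSingleton ℝ (-(x i ^ 2)⁻¹)).det = -(x i ^ 2)⁻¹ := by
    simp
  rw [this, abs_neg, abs_of_nonneg (by positivity)]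
  simp [zpow_neg]

/-- In logarithmic coordinates the set is a hyperplane. -/
lemma volume_sum_mul_log_eq (a : ι → ℝ) (ha : ∃ i, a i ≠ 0) (b : ℝ) :
    volume {u : ι → ℝ | (∀ i, 0 < u i) ∧ ∑ i, a i * Real.log (u i) = b} = 0 := by
  classical
  let f : (ι → ℝ) →ᵃ[ℝ] ℝ :=
    ((∑ i, a i • LinearMap.proj (R := ℝ) (φ := fun _ : ι => ℝ) i) : (ι → ℝ) →ₗ[ℝ] ℝ).toAffineMap
  have hf : ∀ v, f v = ∑ i, a i * v i := fun v => by simp [f]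
  let H : AffineSubspace ℝ (ι → ℝ) := (AffineSubspace.mk' b (⊥ : Submodule ℝ ℝ)).comap f
  have hH : ∀ v, v ∈ H ↔ ∑ i, a i * v i = b := fun v => by
    rw [AffineSubspace.mem_comap, AffineSubspace.mem_mk', hf, vsub_eq_sub, Submodule.mem_bot,
      sub_eq_zero]
  have hHtop : H ≠ ⊤ := by
    intro htop
    obtain ⟨i, hi⟩ := ha
    have h0 : (0 : ι → ℝ) ∈ H := htop ▸ AffineSubspace.mem_top ℝ _ _
    have h1 : (Pi.single i 1 : ι → ℝ) ∈ H := htop ▸ AffineSubspace.mem_top ℝ _ _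
    rw [hH] at h0 h1
    simp only [Pi.zero_apply, mul_zero, Finset.sum_const_zero] at h0
    rw [Finset.sum_eq_single i (fun j _ hj => by simp [hj]) (by simp)] at h1
    simp only [Pi.single_eq_same, mul_one] at h1
    exact hi (h1.trans h0.symm)
  have hnull : volume ((fun (v : ι → ℝ) i => Real.exp (v i)) '' (H : Set (ι → ℝ))) = 0 := by
    refine addHaar_image_eq_zero_of_differentiableOn_of_addHaar_eq_zero volume ?_
      (Measure.addHaar_affineSubspace volume H hHtop)
    fun_prop
  refine measure_mono_null (fun u hu => ?_) hnull
  refine ⟨fun i => Real.log (u i), (hH _).2 hu.2, ?_⟩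
  ext i
  exact Real.exp_log (hu.1 i)

end Orthant

/-- The integrable majorant in one coordinate is `u ^ (δ - 1)` on `(0, 1]` and `u ^ (-1 - δ)` on
`(1, ∞)`. -/
lemma integrable_exp_neg_log {δ : ℝ} (hδ : 0 < δ) :
    Integrable ((Set.Ioi (0 : ℝ)).indicator
      fun u => Real.exp (-Real.log u - δ * |Real.log u|)) := by
  rw [integrable_indicator_iff measurableSet_Ioi, ← Set.Ioc_union_Ioi_eq_Ioi zero_le_one]
  refine IntegrableOn.union ?_ ?_
  · have h1 : IntegrableOn (fun u : ℝ => u ^ (δ - 1)) (Set.Ioc 0 1) :=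
      (intervalIntegrable_iff_integrableOn_Ioc_of_le zero_le_one).1
        (intervalIntegral.intervalIntegrable_rpow' (by linarith))
    refine h1.congr_fun (fun u hu => ?_) measurableSet_Ioc
    simp only
    rw [Real.rpow_def_of_pos hu.1, abs_of_nonpos (Real.log_nonpos hu.1.le hu.2)]
    ring_nf
  · have h1 : IntegrableOn (fun u : ℝ => u ^ (-1 - δ)) (Set.Ioi 1) :=
      integrableOn_Ioi_rpow_of_lt (by linarith) one_pos
    refine h1.congr_fun (fun u hu => ?_) measurableSet_Ioi
    have hu' : (1 : ℝ) < u := hu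
    simp only
    rw [Real.rpow_def_of_pos (by linarith), abs_of_nonneg (Real.log_nonneg hu'.le)]
    ring_nf

/-! ### The two blocks of coordinates -/

section Blocks

variable {m : ℕ} (κ : Fin m → ℝ)

/-- A vector, split into the coordinates with `κ j > 0` and the remaining ones. -/
abbrev Blocks : Type :=
  ({j : Fin m // 0 < κ j} → ℝ) × ({j : Fin m // ¬ 0 < κ j} → ℝ)

/-- The vector with the coordinates `p.1` where `κ j > 0` and `p.2` elsewhere. -/
noncomputable def glue (p : Blocks κ) : Fin m → ℝ :=
  (MeasurableEquiv.piEquivPiSubtypeProd (fun _ : Fin m => ℝ) (fun j => 0 < κ j)).symm p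

lemma measurable_glue : Measurable (glue κ) :=
  MeasurableEquiv.measurable _

lemma measurable_glue_inv : Measurable fun p : Blocks κ => glue κ (fun j => (p.1 j)⁻¹, p.2) :=
  (measurable_glue κ).comp (by fun_prop)

variable (p : Blocks κ)

lemma glue_pos (j : {j : Fin m // 0 < κ j}) : glue κ p j = p.1 j := by
  have : glue κ p j = if h : 0 < κ j then p.1 ⟨j, h⟩ else p.2 ⟨j, h⟩ := rfl
  rw [this, dif_pos j.2]

lemma glue_not_pos (j : {j : Fin m // ¬ 0 < κ j}) : glue κ p j = p.2 j := by
  have : glue κ p j = if h : 0 < κ j then p.1 ⟨j, h⟩ else p.2 ⟨j, h⟩ := rfl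
  rw [this, dif_neg j.2]

variable {κ p}

lemma glue_forall_pos (h1 : ∀ j, 0 < p.1 j) (h2 : ∀ j, 1 ≤ p.2 j) (j : Fin m) :
    0 < glue κ p j := by
  by_cases hj : 0 < κ j
  · exact (h1 ⟨j, hj⟩).trans_eq (glue_pos κ p ⟨j, hj⟩).symm
  · exact (zero_lt_one.trans_le (h2 ⟨j, hj⟩)).trans_eq (glue_not_pos κ p ⟨j, hj⟩).symm

lemma fst_pos_of_glue_mem_M {n : ℕ} {A : Matrix (Fin n) (Fin m) ℝ} (hκ : IsOptimal A κ)
    (h : glue κ p ∈ M A) (j : {j // 0 < κ j}) : 0 < p.1 j :=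
  (pos_of_mem_M hκ h j.2).trans_eq (glue_pos κ p j)

lemma sum_glue (g : Fin m → ℝ → ℝ) :
    ∑ j, g j (glue κ p j) = (∑ j : {j // 0 < κ j}, g j (p.1 j)) +
      ∑ j : {j // ¬ 0 < κ j}, g j (p.2 j) := by
  rw [← Fintype.sum_subtype_add_sum_subtype (fun j => 0 < κ j)]
  simp only [glue_pos, glue_not_pos]

end Blocks

/-! ### The limit measure of `M A` -/

section Limit

variable {n m : ℕ} {A : Matrix (Fin n) (Fin m) ℝ} {κ : Fin m → ℝ}
variable {Ω : Type*} [MeasurableSpace Ω] {P : Measure Ω}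
variable {X : Fin m → Ω → ℝ}

/-- The joint law of the `X j` with `κ j ≤ 0`. -/
noncomputable def restLaw (P : Measure Ω) (κ : Fin m → ℝ) (X : Fin m → Ω → ℝ) :
    Measure ({j : Fin m // ¬ 0 < κ j} → ℝ) :=
  P.map fun ω (j : {j : Fin m // ¬ 0 < κ j}) => X j ω

lemma restLaw_eq_pi (hX : ∀ j, Measurable (X j)) (hindep : iIndepFun X P) :
    restLaw P κ X = Measure.pi fun j : {j : Fin m // ¬ 0 < κ j} => P.map (X j) :=
  (hindep.precomp Subtype.val_injective).map_fun_eq_pi_map fun j => (hX j).aemeasurable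

lemma ae_restLaw_one_le (hX : ∀ j, Measurable (X j))
    (hone : ∀ j, ¬ 0 < κ j → ∀ᵐ ω ∂P, 1 ≤ X j ω) :
    ∀ᵐ z ∂(restLaw P κ X), ∀ j, 1 ≤ z j := by
  refine ae_all_iff.2 fun j => ?_
  rw [restLaw, ae_map_iff (measurable_pi_lambda _ fun j : {j // ¬ 0 < κ j} => hX j).aemeasurable
    (measurableSet_le measurable_const (measurable_pi_apply j))]
  exact hone j j.2

lemma tendsto_rpow_pos_atTop (j : {j // 0 < κ j}) :
    Tendsto (fun t : ℝ => t ^ κ j) atTop atTop := tendsto_rpow_atTop j.2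

lemma eventually_tail_ne_zero
    (hpos : ∀ j, 0 < κ j → RegularlyVarying P (X j) (-1)) :
    ∀ᶠ t : ℝ in atTop, ∀ j : {j // 0 < κ j}, P {ω | t ^ κ j < X j ω} ≠ 0 :=
  eventually_all.2 fun j =>
    (tendsto_rpow_pos_atTop j).eventually (hpos j j.2).eventually_ne_zero

variable [IsProbabilityMeasure P]

lemma isProbabilityMeasure_restLaw (hX : ∀ j, Measurable (X j)) :
    IsProbabilityMeasure (restLaw P κ X) :=
  Measure.isProbabilityMeasure_map
    (measurable_pi_lambda _ fun j : {j // ¬ 0 < κ j} => hX j).aemeasurable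

/-- Substituting `x = u⁻¹` turns the density `∏ x_j⁻²` into Lebesgue measure. -/
lemma setLIntegral_lebesgueProdLaw (hκ : IsOptimal A κ) (hX : ∀ j, Measurable (X j)) :
    ∫⁻ x in M A, ENNReal.ofReal (∏ j with 0 < κ j, x j ^ (-2 : ℤ)) ∂(lebesgueProdLaw P κ X) =
      (volume.prod (restLaw P κ X)) {p : Blocks κ | glue κ (fun j => (p.1 j)⁻¹, p.2) ∈ M A} := by
  have hprob := isProbabilityMeasure_restLaw (P := P) (κ := κ) hX
  have hM := measurableSet_M A
  have hprod : ∀ x : Fin m → ℝ, (∏ j with 0 < κ j, x j ^ (-2 : ℤ)) =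
      ∏ j : {j // 0 < κ j}, x j ^ (-2 : ℤ) := fun x =>
    Finset.prod_subtype _ (by simp) _
  have hmeas : Measurable fun x : Fin m → ℝ =>
      ENNReal.ofReal (∏ j : {j // 0 < κ j}, x j ^ (-2 : ℤ)) := by
    refine (Finset.measurable_prod _ fun j _ => ?_).ennreal_ofReal
    exact (measurable_pi_apply _).pow_const _
  have hlaw : lebesgueProdLaw P κ X = (volume.prod (restLaw P κ X)).map (glue κ) := rfl
  have hset : {p : Blocks κ | glue κ (fun j => (p.1 j)⁻¹, p.2) ∈ M A} =
      (fun p : Blocks κ => glue κ (fun j => (p.1 j)⁻¹, p.2)) ⁻¹' M A := rfl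
  simp only [hprod]
  rw [hlaw, setLIntegral_map hM hmeas (measurable_glue κ),
    ← lintegral_indicator (measurable_glue κ hM), lintegral_prod_symm, hset,
    Measure.prod_apply_symm (measurable_glue_inv κ hM)]
  · refine lintegral_congr fun z => ?_
    have hS : MeasurableSet {u : {j // 0 < κ j} → ℝ | glue κ (u, z) ∈ M A} :=
      ((measurable_glue κ).comp measurable_prodMk_right) hM
    have h := setLIntegral_prod_zpow_neg_two hS fun u hu => fst_pos_of_glue_mem_M hκ hu
    refine Eq.trans ?_ h
    rw [← lintegral_indicator hS]
    refine lintegral_congr fun u => ?_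
    simp only [Set.indicator, Set.mem_preimage, Set.mem_ofPred_eq, glue_pos]
    rfl
  · exact ((hmeas.comp (measurable_glue κ)).indicator (measurable_glue κ hM)).aemeasurable

/-- The boundary of `M A`, after the substitution `x = u⁻¹`, is a null set. -/
lemma ae_mulVec_log_ne_zero (hκ : IsFeasible A κ) (hX : ∀ j, Measurable (X j)) (i : Fin n) :
    ∀ᵐ p : Blocks κ ∂(volume.prod (restLaw P κ X)), (∀ j, 0 < p.1 j) →
      (A *ᵥ fun j => Real.log (glue κ (fun j => (p.1 j)⁻¹, p.2) j)) i ≠ 0 := by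
  have hprob := isProbabilityMeasure_restLaw (P := P) (κ := κ) hX
  set B : Set (Blocks κ) :=
    {p | (∀ j, 0 < p.1 j) ∧
      ∑ j : {j // 0 < κ j}, A i j * Real.log (p.1 j) =
        ∑ j : {j // ¬ 0 < κ j}, A i j * Real.log (p.2 j)} with hB
  have hBm : MeasurableSet B := by
    have h1 : MeasurableSet {p : Blocks κ | ∀ j, 0 < p.1 j} := by
      simp only [Set.ofPred_forall]
      exact MeasurableSet.iInter fun j => measurableSet_lt measurable_const (by fun_prop)
    exact h1.inter (measurableSet_eq_fun (by fun_prop) (by fun_prop))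
  have hB0 : (volume.prod (restLaw P κ X)) B = 0 := by
    rw [Measure.prod_apply_symm hBm]
    refine (lintegral_congr fun z => ?_).trans lintegral_zero
    obtain ⟨j, hj, hij⟩ := exists_entry_ne_zero hκ i
    exact volume_sum_mul_log_eq (fun j : {j // 0 < κ j} => A i j) ⟨⟨j, hj⟩, hij⟩
      (∑ j : {j // ¬ 0 < κ j}, A i j * Real.log (z j))
  filter_upwards [measure_eq_zero_iff_ae_notMem.1 hB0] with p hp hpos h0
  refine hp ⟨hpos, ?_⟩
  have h1 : ∑ j, A i j * Real.log (glue κ (fun j => (p.1 j)⁻¹, p.2) j) = 0 := h0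
  rw [sum_glue fun j x => A i j * Real.log x] at h1
  simp only [Real.log_inv, mul_neg, Finset.sum_neg_distrib] at h1
  linarith

/-! ### The law of the power products as a Lebesgue measure -/

/-- The tail quantile transformation of the coordinates with `κ j > 0`, at the level `t`: on the open
orthant, the image of Lebesgue measure is the normalized law of the `X j / t ^ κ j`. -/
noncomputable def quantileMap (P : Measure Ω) (κ : Fin m → ℝ) (X : Fin m → Ω → ℝ) (t : ℝ)
    (u : {j : Fin m // 0 < κ j} → ℝ) (j : {j : Fin m // 0 < κ j}) : ℝ :=
  tailQuantile (tailLaw P (X j) (t ^ κ j)) (u j)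

lemma measurable_quantileMap {t : ℝ}
    (hp : ∀ j : {j // 0 < κ j}, P {ω | t ^ κ j < X j ω} ≠ 0) :
    Measurable (quantileMap P κ X t) := by
  refine measurable_pi_lambda _ fun j => ?_
  have := isFiniteMeasure_tailLaw (hp j)
  exact (measurable_tailQuantile _).comp (measurable_pi_apply j)

lemma measurable_glue_quantileMap {t : ℝ}
    (hp : ∀ j : {j // 0 < κ j}, P {ω | t ^ κ j < X j ω} ≠ 0) :
    Measurable fun p : Blocks κ =>
      glue κ (quantileMap P κ X t p.1, p.2) :=
  (measurable_glue κ).comp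
    (((measurable_quantileMap hp).comp measurable_fst).prodMk measurable_snd)

/-- Up to the normalizing product, the probability in question depends on `t` only through the
quantile maps. -/
lemma prob_powerProd_gt (hκ : IsOptimal A κ) (hAκ : ∀ i, (A *ᵥ κ) i = 1)
    (hX : ∀ j, Measurable (X j)) (hindep : iIndepFun X P)
    (hnonneg : ∀ j, ∀ᵐ ω ∂P, 0 ≤ X j ω) {t : ℝ} (ht : 0 < t)
    (hp : ∀ j : {j // 0 < κ j}, P {ω | t ^ κ j < X j ω} ≠ 0) :
    P {ω | ∀ i, ENNReal.ofReal t < powerProd A (fun j => X j ω) i} =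
      (∏ j : {j // 0 < κ j}, P {ω | t ^ κ j < X j ω}) *
        (volume.prod (restLaw P κ X)) {p : Blocks κ | glue κ (quantileMap P κ X t p.1, p.2) ∈ M A} := by
  have hprob := isProbabilityMeasure_restLaw (P := P) (κ := κ) hX
  have hM := measurableSet_M A
  set Y : Fin m → Ω → ℝ := fun j ω => X j ω / t ^ κ j with hY
  have hYm : ∀ j, Measurable (Y j) := fun j => (hX j).div_const _
  have hYindep : iIndepFun Y P :=
    hindep.comp (fun j x => x / t ^ κ j) fun j => measurable_id.div_const _
  have hYrest : restLaw P κ Y = restLaw P κ X := by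
    unfold restLaw
    congr 1
    ext ω j
    have : κ j = 0 := le_antisymm (not_lt.1 j.2) (hκ.1.1 j)
    simp [hY, this]
  have hYprob : ∀ j, IsProbabilityMeasure (P.map (Y j)) := fun j =>
    Measure.isProbabilityMeasure_map (hYm j).aemeasurable
  have hlaw : ∀ j : {j // 0 < κ j}, P.map (Y j) =
      P {ω | t ^ κ j < X j ω} • tailLaw P (X j) (t ^ κ j) := fun j =>
    map_div_eq_smul_tailLaw (hp j)
  have hfin : ∀ j : {j // 0 < κ j}, IsFiniteMeasure (tailLaw P (X j) (t ^ κ j)) := fun j =>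
    isFiniteMeasure_tailLaw (hp j)
  have hglue : MeasurePreserving (glue κ)
      ((Measure.pi fun j : {j // 0 < κ j} => P.map (Y j)).prod (restLaw P κ X))
      (Measure.pi fun j => P.map (Y j)) := by
    rw [← hYrest, restLaw_eq_pi hYm hYindep]
    exact (measurePreserving_piEquivPiSubtypeProd (fun j => P.map (Y j)) fun j => 0 < κ j).symm
  calc P {ω | ∀ i, ENNReal.ofReal t < powerProd A (fun j => X j ω) i}
      = P ((fun ω j => Y j ω) ⁻¹' M A) := by
        refine measure_congr ?_
        filter_upwards [ae_all_iff.2 hnonneg] with ω hω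
        refine propext ?_
        have h0 : ∀ j, 0 ≤ Y j ω := fun j => div_nonneg (hω j) (Real.rpow_pos_of_pos ht _).le
        exact (forall_congr' fun i => lt_powerProd_iff hAκ ht _ i).trans
          (and_iff_right h0).symm
    _ = (Measure.pi fun j => P.map (Y j)) (M A) := by
        rw [← Measure.map_apply (measurable_pi_lambda _ hYm) hM,
          hYindep.map_fun_eq_pi_map fun j => (hYm j).aemeasurable]
    _ = ((Measure.pi fun j : {j // 0 < κ j} => P.map (Y j)).prod (restLaw P κ X))
          (glue κ ⁻¹' M A) := (hglue.measure_preimage hM.nullMeasurableSet).symm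
    _ = _ := by
        have hset : {p : Blocks κ | glue κ (quantileMap P κ X t p.1, p.2) ∈ M A} =
          (fun p : Blocks κ => glue κ (quantileMap P κ X t p.1, p.2)) ⁻¹' M A := rfl
        rw [Measure.prod_apply_symm (measurable_glue κ hM),
          hset, Measure.prod_apply_symm (measurable_glue_quantileMap hp hM),
          ← lintegral_const_mul _ (measurable_measure_prodMk_right
            (measurable_glue_quantileMap hp hM))]
        refine lintegral_congr fun z => ?_
        have hS : MeasurableSet {u : {j // 0 < κ j} → ℝ | glue κ (u, z) ∈ M A} :=
          ((measurable_glue κ).comp measurable_prodMk_right) hM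
        refine (pi_apply_of_smul hlaw _).trans ?_
        congr 1
        exact pi_apply_eq_volume_tailQuantile _ hS fun u hu => fst_pos_of_glue_mem_M hκ hu

/-! ### Dominated convergence -/

/-- If `log u ≤ K - s + θ |s|`, then `log u + θ |log u|` is bounded in the same way. -/
lemma add_mul_abs_le {θ K s v : ℝ} (hθ : 0 ≤ θ) (hθ1 : θ ≤ 1) (h : v ≤ K - s + θ * |s|) :
    v + θ * |v| ≤ 2 * |K| - s + 3 * θ * |s| := by
  have h1 := le_abs_self s
  have h2 := neg_abs_le s
  have h3 := le_abs_self K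
  have h4 := abs_nonneg s
  have h5 := abs_nonneg K
  have h6 : θ * θ * |s| ≤ θ * |s| := by
    have : θ * θ ≤ θ := by nlinarith
    gcongr
  have h7 : θ * K ≤ |K| := by nlinarith
  have h8 : -(θ * K) ≤ |K| := by nlinarith [neg_abs_le K]
  rcases le_total 0 v with hv | hv
  · rw [abs_of_nonneg hv]
    nlinarith [mul_le_mul_of_nonneg_left h hθ, mul_le_mul_of_nonneg_left h2 hθ]
  · rw [abs_of_nonpos hv]
    nlinarith [mul_le_mul_of_nonneg_left h (sub_nonneg.2 hθ1), mul_le_mul_of_nonneg_left h1 hθ,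
      mul_nonneg hθ h4, mul_nonneg (mul_nonneg hθ hθ) h4]

/-- The integrable majorant. Coercivity of the objective on the cone of feasible directions bounds
`∏ y_j` from below on `M A`, with room to absorb the errors in the Potter bounds. -/
lemma exists_integrable_majorant (hκ : IsUniqueOptimal A κ)
    (hX : ∀ j, Measurable (X j)) (hindep : iIndepFun X P)
    (hpos : ∀ j, 0 < κ j → RegularlyVarying P (X j) (-1))
    (hmom : ∀ j, ¬ 0 < κ j → ∀ δ : ℝ, 0 < δ → δ < 1 →
      Integrable (fun ω => X j ω ^ (1 - δ)) P) :
    ∃ D : Blocks κ → ℝ,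
      Integrable D (volume.prod (restLaw P κ X)) ∧
      ∀ᶠ t in atTop, ∀ p, (∀ j, 1 ≤ p.2 j) →
        glue κ (quantileMap P κ X t p.1, p.2) ∈ M A → 1 ≤ D p := by
  have hprob := isProbabilityMeasure_restLaw (P := P) (κ := κ) hX
  obtain ⟨δ, hδ, hδ1, hcone⟩ := hκ.exists_mul_sum_abs_le
  have hθ : 0 < δ / 3 := by positivity
  choose K hK using fun j : {j // 0 < κ j} =>
    (hpos j j.2).exists_log_le (hX j) hθ (by linarith : δ / 3 < 1)
  refine ⟨fun p => Real.exp (∑ j, 2 * |K j|) *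
    ((∏ j, (Set.Ioi (0 : ℝ)).indicator
      (fun u => Real.exp (-Real.log u - δ / 3 * |Real.log u|)) (p.1 j)) *
        ∏ j, p.2 j ^ (1 - δ)), ?_, ?_⟩
  · refine Integrable.const_mul (Integrable.mul_prod (f := fun u : {j // 0 < κ j} → ℝ =>
      ∏ j, (Set.Ioi (0 : ℝ)).indicator
        (fun u => Real.exp (-Real.log u - δ / 3 * |Real.log u|)) (u j))
      (g := fun z : {j // ¬ 0 < κ j} → ℝ => ∏ j, z j ^ (1 - δ)) ?_ ?_) _
    · exact Integrable.fintype_prod fun _ => integrable_exp_neg_log hθ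
    · rw [restLaw_eq_pi hX hindep]
      have : ∀ j : {j // ¬ 0 < κ j}, IsProbabilityMeasure (P.map (X j)) := fun j =>
        Measure.isProbabilityMeasure_map (hX j).aemeasurable
      refine Integrable.fintype_prod (f := fun _ x => x ^ (1 - δ)) fun j => ?_
      rw [integrable_map_measure (by fun_prop) (hX j).aemeasurable]
      exact hmom j j.2 δ hδ hδ1
  · have hev : ∀ᶠ t : ℝ in atTop, ∀ j : {j // 0 < κ j}, ∀ u : ℝ,
        0 < tailQuantile (tailLaw P (X j) (t ^ κ j)) u →
        0 < u ∧ Real.log u ≤ K j - Real.log (tailQuantile (tailLaw P (X j) (t ^ κ j)) u) +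
          δ / 3 * |Real.log (tailQuantile (tailLaw P (X j) (t ^ κ j)) u)| :=
      eventually_all.2 fun j => (tendsto_rpow_pos_atTop j).eventually (hK j)
    filter_upwards [hev] with t ht p hp2 hpM
    set q := quantileMap P κ X t p.1 with hq
    have hqpos : ∀ j, 0 < q j := fst_pos_of_glue_mem_M hκ.1 hpM
    have hupos : ∀ j, 0 < p.1 j := fun j => (ht j _ (hqpos j)).1
    have hglue := glue_forall_pos (κ := κ) (p := (q, p.2)) hqpos hp2
    have hz : ∀ j, 0 ≤ Real.log (p.2 j) := fun j => Real.log_nonneg (hp2 j)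
    have h1 := hcone (fun j => Real.log (glue κ (q, p.2) j))
      (fun i => ((mem_M_iff_of_pos A hglue).1 hpM i).le)
      (fun j hj => (hz ⟨j, hj⟩).trans_eq
        (congrArg Real.log (glue_not_pos κ (q, p.2) ⟨j, hj⟩)).symm)
    rw [sum_glue fun _ x => |Real.log x|, sum_glue fun _ x => Real.log x] at h1
    simp only [abs_of_nonneg (hz _)] at h1
    have h2 : ∑ j, (Real.log (p.1 j) + δ / 3 * |Real.log (p.1 j)|) ≤
        ∑ j, (2 * |K j| - Real.log (q j) + 3 * (δ / 3) * |Real.log (q j)|) :=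
      Finset.sum_le_sum fun j _ =>
        add_mul_abs_le hθ.le (by linarith) (ht j _ (hqpos j)).2
    have h5 : ∑ j, (2 * |K j| - Real.log (q j) + 3 * (δ / 3) * |Real.log (q j)|) =
        ∑ j, 2 * |K j| - ∑ j, Real.log (q j) + δ * ∑ j, |Real.log (q j)| := by
      rw [Finset.sum_add_distrib, Finset.sum_sub_distrib, ← Finset.mul_sum _ _ (3 * (δ / 3)),
        mul_div_cancel₀ _ (three_ne_zero' ℝ)]
    have h3 : ∏ j, (Set.Ioi (0 : ℝ)).indicator
        (fun u => Real.exp (-Real.log u - δ / 3 * |Real.log u|)) (p.1 j) =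
        Real.exp (-∑ j, (Real.log (p.1 j) + δ / 3 * |Real.log (p.1 j)|)) := by
      rw [← Finset.sum_neg_distrib, Real.exp_sum]
      refine Finset.prod_congr rfl fun j _ => ?_
      rw [Set.indicator_of_mem (Set.mem_Ioi.2 (hupos j))]
      ring_nf
    have h4 : ∏ j, p.2 j ^ (1 - δ) = Real.exp ((1 - δ) * ∑ j, Real.log (p.2 j)) := by
      rw [Finset.mul_sum, Real.exp_sum]
      refine Finset.prod_congr rfl fun j _ => ?_
      rw [Real.rpow_def_of_pos (zero_lt_one.trans_le (hp2 j)), mul_comm]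
    simp only [h3, h4]
    rw [← Real.exp_add, ← Real.exp_add]
    refine Real.one_le_exp ?_
    linarith

/-- Pointwise convergence of the indicator of `M A` along the quantile maps, off its boundary. -/
lemma eventually_glue_quantileMap_mem_iff (hκ : IsOptimal A κ) (hX : ∀ j, Measurable (X j))
    (hpos : ∀ j, 0 < κ j → RegularlyVarying P (X j) (-1))
    {p : Blocks κ} (hp2 : ∀ j, 1 ≤ p.2 j)
    (hp : (∀ j, 0 < p.1 j) →
      ∀ i, (A *ᵥ fun j => Real.log (glue κ (fun j => (p.1 j)⁻¹, p.2) j)) i ≠ 0) :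
    ∀ᶠ t in atTop, (glue κ (quantileMap P κ X t p.1, p.2) ∈ M A ↔
      glue κ (fun j => (p.1 j)⁻¹, p.2) ∈ M A) := by
  by_cases hu : ∀ j, 0 < p.1 j
  · have hlim : ∀ j, Tendsto (fun t => quantileMap P κ X t p.1 j) atTop (𝓝 (p.1 j)⁻¹) := fun j =>
      ((hpos j j.2).tendsto_tailQuantile (hX j) (hu j)).comp (tendsto_rpow_pos_atTop j)
    have hq : ∀ᶠ t in atTop, ∀ j, 0 < quantileMap P κ X t p.1 j :=
      eventually_all.2 fun j => (hlim j).eventually (lt_mem_nhds (inv_pos.2 (hu j)))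
    have hui : ∀ j, 0 < (p.1 j)⁻¹ := fun j => inv_pos.2 (hu j)
    have hrow : ∀ i, Tendsto
        (fun t => (A *ᵥ fun j => Real.log (glue κ (quantileMap P κ X t p.1, p.2) j)) i) atTop
        (𝓝 ((A *ᵥ fun j => Real.log (glue κ (fun j => (p.1 j)⁻¹, p.2) j)) i)) := by
      intro i
      simp only [Matrix.mulVec, dotProduct]
      rw [sum_glue fun j x => A i j * Real.log x]
      simp only [sum_glue fun j x => A i j * Real.log x]
      refine Tendsto.add (tendsto_finsetSum _ fun j _ => ?_) tendsto_const_nhds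
      exact ((hlim j).log (hui j).ne').const_mul _
    have hsign : ∀ᶠ t in atTop, ∀ i,
        (0 < (A *ᵥ fun j => Real.log (glue κ (quantileMap P κ X t p.1, p.2) j)) i ↔
          0 < (A *ᵥ fun j => Real.log (glue κ (fun j => (p.1 j)⁻¹, p.2) j)) i) := by
      refine eventually_all.2 fun i => ?_
      rcases lt_or_gt_of_ne (hp hu i) with hi | hi
      · filter_upwards [(hrow i).eventually (gt_mem_nhds hi)] with t ht
        exact iff_of_false ht.not_gt hi.not_gt
      · filter_upwards [(hrow i).eventually (lt_mem_nhds hi)] with t ht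
        exact iff_of_true ht hi
    filter_upwards [hq, hsign] with t ht hs
    exact (mem_M_iff_of_pos A (glue_forall_pos (p := (_, p.2)) ht hp2)).trans
      ((forall_congr' hs).trans
        (mem_M_iff_of_pos A (glue_forall_pos (p := (_, p.2)) hui hp2)).symm)
  · -- neither point has only positive coordinates
    filter_upwards [eventually_tail_ne_zero hpos] with t ht
    refine iff_of_false (fun h => hu fun j => ?_) (fun h => hu fun j => ?_)
    · have := isFiniteMeasure_tailLaw (ht j)
      exact ((lt_tailQuantile_iff _ le_rfl).1 (fst_pos_of_glue_mem_M hκ h j)).1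
    · exact inv_pos.1 (fst_pos_of_glue_mem_M hκ h j)

/-- The limit theorem, and the finiteness of the limit, in the coordinates of the quantile
transformation. -/
lemma tendsto_measure_quantileMap (hκ : IsUniqueOptimal A κ)
    (hX : ∀ j, Measurable (X j)) (hindep : iIndepFun X P)
    (hpos : ∀ j, 0 < κ j → RegularlyVarying P (X j) (-1))
    (hone : ∀ j, ¬ 0 < κ j → ∀ᵐ ω ∂P, 1 ≤ X j ω)
    (hmom : ∀ j, ¬ 0 < κ j → ∀ δ : ℝ, 0 < δ → δ < 1 →
      Integrable (fun ω => X j ω ^ (1 - δ)) P) :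
    (volume.prod (restLaw P κ X)) {p : Blocks κ | glue κ (fun j => (p.1 j)⁻¹, p.2) ∈ M A} ≠ ∞ ∧
    Tendsto (fun t => (volume.prod (restLaw P κ X))
        {p : Blocks κ | glue κ (quantileMap P κ X t p.1, p.2) ∈ M A}) atTop
      (𝓝 ((volume.prod (restLaw P κ X)) {p : Blocks κ | glue κ (fun j => (p.1 j)⁻¹, p.2) ∈ M A})) := by
  have hprob := isProbabilityMeasure_restLaw (P := P) (κ := κ) hX
  have hM := measurableSet_M A
  obtain ⟨D, hD, hbound⟩ := exists_integrable_majorant hκ hX hindep hpos hmom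
  have hone' : ∀ᵐ p ∂((volume : Measure ({j // 0 < κ j} → ℝ)).prod (restLaw P κ X)),
      ∀ j, 1 ≤ p.2 j :=
    Measure.quasiMeasurePreserving_snd.ae (ae_restLaw_one_le hX hone)
  have hne := ae_all_iff.2 fun i => ae_mulVec_log_ne_zero (P := P) hκ.1.1 hX i
  have hSm : MeasurableSet {p : Blocks κ | glue κ (fun j => (p.1 j)⁻¹, p.2) ∈ M A} :=
    measurable_glue_inv κ hM
  have hlim : ∀ᵐ p ∂((volume : Measure ({j // 0 < κ j} → ℝ)).prod (restLaw P κ X)),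
      ∀ᶠ t in atTop, (glue κ (quantileMap P κ X t p.1, p.2) ∈ M A ↔
        glue κ (fun j => (p.1 j)⁻¹, p.2) ∈ M A) := by
    filter_upwards [hone', hne] with p hp2 hp
    exact eventually_glue_quantileMap_mem_iff hκ.1 hX hpos hp2 fun h i => hp i h
  have hDtop : ∫⁻ p, ENNReal.ofReal (D p) ∂(volume.prod (restLaw P κ X)) ≠ ∞ :=
    hD.lintegral_lt_top.ne
  constructor
  · rw [← lintegral_indicator_one hSm]
    refine ne_top_of_le_ne_top hDtop (lintegral_mono_ae ?_)
    filter_upwards [hone', hlim] with p hp2 hp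
    refine Set.indicator_apply_le' (fun hmem => ?_) (fun _ => zero_le)
    obtain ⟨t, ht, htb⟩ := (hp.and hbound).exists
    exact ENNReal.one_le_ofReal.2 (htb p hp2 (ht.2 hmem))
  · have h := tendsto_lintegral_filter_of_dominated_convergence
      (μ := (volume : Measure ({j // 0 < κ j} → ℝ)).prod (restLaw P κ X)) (l := atTop)
      (F := fun t : ℝ => Set.indicator {p : Blocks κ | glue κ (quantileMap P κ X t p.1, p.2) ∈ M A} 1)
      (f := Set.indicator {p : Blocks κ | glue κ (fun j => (p.1 j)⁻¹, p.2) ∈ M A} 1)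
      (fun p => ENNReal.ofReal (D p)) ?_ ?_ hDtop ?_
    · rw [lintegral_indicator_one hSm] at h
      refine h.congr' ?_
      filter_upwards [eventually_tail_ne_zero hpos] with t ht
      exact lintegral_indicator_one (measurable_glue_quantileMap ht hM)
    · filter_upwards [eventually_tail_ne_zero hpos] with t ht
      exact measurable_one.indicator (measurable_glue_quantileMap ht hM)
    · filter_upwards [hbound] with t ht
      filter_upwards [hone'] with p hp2
      exact Set.indicator_apply_le' (fun hmem => ENNReal.one_le_ofReal.2 (ht p hp2 hmem))
        (fun _ => zero_le)
    · filter_upwards [hlim] with p hp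
      refine tendsto_const_nhds.congr' ?_
      filter_upwards [hp] with t ht
      by_cases h : glue κ (fun j => (p.1 j)⁻¹, p.2) ∈ M A
      · exact (Set.indicator_of_mem (a := p) h 1).trans
          (Set.indicator_of_mem (a := p) (ht.2 h) 1).symm
      · exact (Set.indicator_of_notMem (a := p) h 1).trans
          (Set.indicator_of_notMem (a := p) (fun h' => h (ht.1 h')) 1).symm

end Limit

end PowerProducts

theorem proposition4p1 {n m : ℕ} (A : Matrix (Fin n) (Fin m) ℝ) (κ : Fin m → ℝ)
    (hκ : PowerProducts.IsUniqueOptimal A κ) (hAκ : ∀ i, (A *ᵥ κ) i = 1)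
    {Ω : Type*} [MeasurableSpace Ω] (P : Measure Ω) [IsProbabilityMeasure P]
    (X : Fin m → Ω → ℝ) (hX : ∀ j, Measurable (X j)) (hindep : iIndepFun X P)
    (hnonneg : ∀ j, ∀ᵐ ω ∂P, 0 ≤ X j ω)
    (hpos : ∀ j, 0 < κ j → PowerProducts.RegularlyVarying P (X j) (-1))
    (hone : ∀ j, ¬ 0 < κ j → ∀ᵐ ω ∂P, 1 ≤ X j ω)
    (hmom : ∀ j, ¬ 0 < κ j → ∀ δ : ℝ, 0 < δ → δ < 1 →
      Integrable (fun ω => X j ω ^ (1 - δ)) P) :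
    IntegrableOn (fun x : Fin m → ℝ => ∏ j with 0 < κ j, x j ^ (-2 : ℤ))
        (PowerProducts.M A) (PowerProducts.lebesgueProdLaw P κ X) ∧
      Tendsto
        (fun x : ℝ =>
          P.real {ω | ∀ i, ENNReal.ofReal x < PowerProducts.powerProd A (fun j => X j ω) i} /
            ∏ j with 0 < κ j, P.real {ω | x ^ κ j < X j ω})
        atTop
        (𝓝 (∫ x in PowerProducts.M A, ∏ j with 0 < κ j, x j ^ (-2 : ℤ)
          ∂(PowerProducts.lebesgueProdLaw P κ X))) := by
  obtain ⟨hfin, hlim⟩ :=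
    PowerProducts.tendsto_measure_quantileMap hκ hX hindep hpos hone hmom
  have hlint := PowerProducts.setLIntegral_lebesgueProdLaw (P := P) hκ.1 hX
  have hsm : AEStronglyMeasurable (fun x : Fin m → ℝ => ∏ j with 0 < κ j, x j ^ (-2 : ℤ))
      ((PowerProducts.lebesgueProdLaw P κ X).restrict (PowerProducts.M A)) := by
    refine (Finset.measurable_prod _ fun j _ => ?_).aestronglyMeasurable
    exact (measurable_pi_apply j).pow_const _
  have hnn : ∀ x : Fin m → ℝ, 0 ≤ ∏ j with 0 < κ j, x j ^ (-2 : ℤ) := fun x =>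
    Finset.prod_nonneg fun j _ => (even_neg_two (α := ℤ)).zpow_nonneg _
  refine ⟨(lintegral_ofReal_ne_top_iff_integrable hsm (Eventually.of_forall hnn)).1
    (hlint.trans_ne hfin), ?_⟩
  rw [integral_eq_lintegral_of_nonneg_ae (Eventually.of_forall hnn) hsm, hlint]
  refine ((ENNReal.tendsto_toReal hfin).comp hlim).congr' ?_
  filter_upwards [PowerProducts.eventually_tail_ne_zero hpos, eventually_gt_atTop 0] with t hp ht
  have hprob := PowerProducts.prob_powerProd_gt hκ.1 hAκ hX hindep hnonneg ht hp
  have hden : ∏ j with 0 < κ j, P.real {ω | t ^ κ j < X j ω} =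
      ∏ j : {j // 0 < κ j}, P.real {ω | t ^ κ j < X j ω} :=
    Finset.prod_subtype _ (by simp) _
  have hden0 : ∏ j : {j // 0 < κ j}, P.real {ω | t ^ κ j < X j ω} ≠ 0 :=
    Finset.prod_ne_zero_iff.2 fun j _ => (measureReal_ne_zero_iff (measure_ne_top _ _)).2 (hp j)
  rw [measureReal_def, hprob, hden, ENNReal.toReal_mul, ENNReal.toReal_prod]
  exact (mul_div_cancel_left₀ _ hden0).symm
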